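/- Let $G$ be a nontrivial connected compact (Hausdorff) abelian group with normalized Haar measure $m$ and character group $X$ (written multiplicatively). Let $T\subset X$ be a subsemigroup containing the unit character $\mathbf 1$ with $T\cap T^{-1}=\{\mathbf 1\}$ and $X=T^{-1}T$; it defines an order on $X$ by $\xi\le\chi :\Leftrightarrow \chi\xi^{-1}\in T$. Assume that this order is linear, i.e. $T\cup T^{-1}=X$. Let $1<p<\infty$. Let $H^p(G)$ be the subspace of those $f\in L^p(G)$ whose Fourier transform $\widehat f(\chi)=\int_G f\overline{\chi}\,dm$ vanishes for all $\chi\in X\setminus T$. Let $P_T:L^p(G)\to H^p(G)$ be the Riesz projection, i.e. the continuous extension to $L^p(G)$ (which exists by the Bochner–Helson theorem) of the map $\sum_{\chi\in M}c_\chi\chi\mapsto\sum_{\chi\in M\cap T}c_\chi\chi$ ($M\subset X$ finite) on trigonometric polynomials. For $\varphi\in L^\infty(G)$ let $T_\varphi f=P_T(\varphi f)$, $f\in H^p(G)$, be the Toeplitz operator on $H^p(G)$ with symbol $\varphi$, and for $\varphi,\psi\in L^\infty(G)$ let $[T_\varphi,T_\psi):=T_\varphi T_\psi-T_{\varphi\psi}$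 be the semicommutator; in particular $[T_\chi,T_{\bar\chi})=T_\chi T_{\bar\chi}-I$ for $\chi\in X$. Let $X^i$ be the set of characters which have an index, that is, of those $\chi\in X$ such that either $\chi\in T$ and $T\setminus\chi T$ is finite, or $\chi=\chi_1\chi_2^{-1}$ with $\chi_1,\chi_2\in T$ and both $T\setminus\chi_1T$ and $T\setminus\chi_2T$ finite. Then: 1. for every $\chi\in T$, the semicommutator $[T_\chi,T_{\bar\chi})$ is compact on $H^p(G)$ if and only if $\chi\in X^i$; 2. consequently, if $[T_\chi,T_{\bar\chi})$ is compact on $H^p(G)$ for all $\chi\in T$, then $G$ is isomorphic (as a topological group) to the one-dimensional torus $\mathbb T$. -/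

import Mathlib

open MeasureTheory
open scoped ENNReal

noncomputable section

namespace OrderedToeplitz

/-! ### Ordered character groups -/

section Order

variable {X : Type*} [CommGroup X]

/-- `T` is the positive cone of a partial order on the abelian group `X` for which `X` is directed:
`T` is a subsemigroup containing `1` with `T ∩ T⁻¹ = {1}` and `X = T⁻¹T`. -/
structure IsPositiveCone (T : Submonoid X) : Prop where
  eq_one : ∀ χ ∈ T, χ⁻¹ ∈ T → χ = 1
  generates : ∀ χ : X, ∃ ξ ∈ T, ∃ η ∈ T, χ = ξ⁻¹ * η

/-- The order `ξ ≤ χ ↔ χ * ξ⁻¹ ∈ T` is linear: `T` is a positive cone and `T ∪ T⁻¹ = X`. -/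
structure IsLinearPositiveCone (T : Submonoid X) : Prop extends IsPositiveCone T where
  total : ∀ χ : X, χ ∈ T ∨ χ⁻¹ ∈ T

/-- The set `T \ χT`. -/
def coneGap (T : Submonoid X) (χ : X) : Set X :=
  (T : Set X) \ (fun ξ => χ * ξ) '' (T : Set X)

/-- The set `Xⁱ` of the characters that have an index: `χ ∈ T` with `T \ χT` finite, or
`χ = χ₁χ₂⁻¹` with `χ₁, χ₂ ∈ T` and both `T \ χ₁T` and `T \ χ₂T` finite. -/
def indexSet (T : Submonoid X) : Set X :=
  {χ | (χ ∈ T ∧ (coneGap T χ).Finite) ∨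
    ∃ χ₁ ∈ T, ∃ χ₂ ∈ T, χ = χ₁ * χ₂⁻¹ ∧ (coneGap T χ₁).Finite ∧ (coneGap T χ₂).Finite}

end Order

variable {G : Type*} [CommGroup G] [TopologicalSpace G] [IsTopologicalGroup G] [CompactSpace G]
  [MeasurableSpace G] [BorelSpace G]

/-! ### Characters and Fourier coefficients -/

/-- A character of `G` as a continuous complex-valued function. -/
def charFun (χ : PontryaginDual G) : C(G, ℂ) where
  toFun x := (χ x : ℂ)
  continuous_toFun := continuous_subtype_val.comp (map_continuous χ)

/-- A character of `G` as an element of `L^p(G)`, `1 ≤ p ≤ ∞`. -/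
def charLp (p : ℝ≥0∞) [Fact (1 ≤ p)] (μ : Measure G) [IsFiniteMeasure μ]
    (χ : PontryaginDual G) : Lp ℂ p μ :=
  ContinuousMap.toLp p μ ℂ (charFun χ)

/-- The Fourier coefficient `∫ f χ̄ dμ`. -/
def fourierCoef (μ : Measure G) (f : G → ℂ) (χ : PontryaginDual G) : ℂ :=
  ∫ x, f x * star (χ x : ℂ) ∂μ

theorem integrable_mul_star_char {p : ℝ≥0∞} [Fact (1 ≤ p)] {μ : Measure G} [IsFiniteMeasure μ]
    (f : Lp ℂ p μ) (χ : PontryaginDual G) :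
    Integrable (fun x => f x * star (χ x : ℂ)) μ := by
  have hf : Integrable f μ := (Lp.memLp f).integrable Fact.out
  refine hf.mul_bdd (c := 1) ?_ ?_
  · exact ((charFun χ).continuous.star).aestronglyMeasurable
  · exact Filter.Eventually.of_forall fun x => by
      rw [norm_star]
      exact (Circle.norm_coe _).le

theorem fourierCoef_charLp {p : ℝ≥0∞} [Fact (1 ≤ p)] {μ : Measure G} [IsFiniteMeasure μ]
    [μ.IsMulLeftInvariant] {χ ξ : PontryaginDual G} (h : ξ ≠ χ) :
    fourierCoef μ (charLp p μ ξ) χ = 0 := by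
  have h1 : fourierCoef μ (charLp p μ ξ) χ = ∫ x, ((ξ x * (χ x)⁻¹ : Circle) : ℂ) ∂μ := by
    refine integral_congr_ae ?_
    filter_upwards [ContinuousMap.coeFn_toLp (p := p) (𝕜 := ℂ) μ (charFun ξ)] with x hx
    simp only [charLp, hx, Circle.coe_mul, Circle.coe_inv_eq_conj]
    rfl
  obtain ⟨a, ha⟩ : ∃ a, ξ a ≠ χ a := by
    by_contra! hcon
    exact h (PontryaginDual.ext hcon)
  have h2 := integral_mul_left_eq_self (μ := μ) (fun x => ((ξ x * (χ x)⁻¹ : Circle) : ℂ)) a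
  have h3 : ∀ x, ((ξ (a * x) * (χ (a * x))⁻¹ : Circle) : ℂ)
      = ((ξ a * (χ a)⁻¹ : Circle) : ℂ) * ((ξ x * (χ x)⁻¹ : Circle) : ℂ) := by
    intro x
    rw [← Circle.coe_mul, map_mul, map_mul, mul_inv]
    congr 1
    exact mul_mul_mul_comm _ _ _ _
  simp only [h3] at h2
  rw [integral_const_mul] at h2
  rw [h1]
  by_contra hne
  have h4 := mul_right_cancel₀ hne (h2.trans (one_mul _).symm)
  have h5 : ξ a * (χ a)⁻¹ = 1 := Circle.ext (by simpa using h4)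
  exact ha (mul_inv_eq_one.mp h5)

/-! ### Hardy spaces, the Riesz projection and Toeplitz operators -/

/-- The Hardy space `H^p(G)`: the functions in `L^p(G)` whose Fourier transform is concentrated
on `T`, with the norm of `L^p(G)`. -/
def hardy (p : ℝ≥0∞) [Fact (1 ≤ p)] (μ : Measure G) [IsFiniteMeasure μ]
    (T : Submonoid (PontryaginDual G)) : Submodule ℂ (Lp ℂ p μ) where
  carrier := {f | ∀ χ, χ ∉ T → fourierCoef μ f χ = 0}
  zero_mem' := by
    intro χ _
    refine (integral_congr_ae ?_).trans (integral_zero G ℂ)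
    filter_upwards [Lp.coeFn_zero ℂ p μ] with x hx
    rw [hx, Pi.zero_apply, zero_mul]
  add_mem' := by
    intro f g hf hg χ hχ
    have h : fourierCoef μ (f + g : Lp ℂ p μ) χ = fourierCoef μ f χ + fourierCoef μ g χ := by
      unfold fourierCoef
      rw [← integral_add (integrable_mul_star_char f χ) (integrable_mul_star_char g χ)]
      refine integral_congr_ae ?_
      filter_upwards [Lp.coeFn_add f g] with x hx
      rw [hx, Pi.add_apply, add_mul]
    rw [h, hf χ hχ, hg χ hχ, add_zero]
  smul_mem' := by
    intro c f hf χ hχ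
    have h : fourierCoef μ (c • f : Lp ℂ p μ) χ = c * fourierCoef μ f χ := by
      unfold fourierCoef
      rw [← integral_const_mul]
      refine integral_congr_ae ?_
      filter_upwards [Lp.coeFn_smul c f] with x hx
      rw [hx, Pi.smul_apply, smul_eq_mul, mul_assoc]
    rw [h, hf χ hχ, mul_zero]

section Operators

variable (p : ℝ≥0∞) [Fact (1 ≤ p)] (μ : Measure G) [IsFiniteMeasure μ] [μ.IsMulLeftInvariant]
  (T : Submonoid (PontryaginDual G))

open Classical in
/-- The image of a character under the Riesz projection: `χ` if `χ ∈ T`, and `0` otherwise. -/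
def rieszChar (χ : PontryaginDual G) : hardy p μ T :=
  if h : χ ∈ T then
    ⟨charLp p μ χ, fun _ hξ => fourierCoef_charLp fun e => hξ (e ▸ h)⟩
  else 0

/-- The graph of the Riesz projection on trigonometric polynomials,
`∑_{χ ∈ M} c_χ χ ↦ ∑_{χ ∈ M ∩ T} c_χ χ`, as a subspace of `L^p(G) × H^p(G)`. -/
def rieszPolGraph : Submodule ℂ (Lp ℂ p μ × hardy p μ T) :=
  LinearMap.range ((Finsupp.linearCombination ℂ (charLp (G := G) p μ)).prod
    (Finsupp.linearCombination ℂ (rieszChar p μ T)))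

/-- The Riesz projection `P_T : L^p(G) → H^p(G)`, the extension by continuity of the one on
trigonometric polynomials: the operator whose graph is the closure of the graph of the latter.
When the order is linear and `1 < p < ∞`, it is bounded and its domain is all of `L^p(G)`
(Bochner--Helson). -/
def rieszProj : Lp ℂ p μ →ₗ.[ℂ] hardy p μ T :=
  (rieszPolGraph p μ T).topologicalClosure.toLinearPMap

open Classical in
/-- The Toeplitz operator `T_φ f = P_T (φ f)` on `H^p(G)` with symbol `φ ∈ L^∞(G)`. (The value `0`
where `φ f` is not in the domain of `P_T` is never taken when the order is linear and
`1 < p < ∞`.) -/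
def toeplitz (φ : Lp ℂ ∞ μ) (f : hardy p μ T) : hardy p μ T :=
  if h : (φ • (f : Lp ℂ p μ) : Lp ℂ p μ) ∈ (rieszProj p μ T).domain then
    rieszProj p μ T ⟨φ • (f : Lp ℂ p μ), h⟩
  else 0

/-- The semicommutator `[T_φ, T_ψ) = T_φ T_ψ - T_{φψ}` on `H^p(G)`. -/
def semicommutator (φ ψ : Lp ℂ ∞ μ) (f : hardy p μ T) : hardy p μ T :=
  toeplitz p μ T φ (toeplitz p μ T ψ f) - toeplitz p μ T (φ • ψ) f

end Operators

end OrderedToeplitz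

end

/-!
On a function `f` in `H^p(G)` and for `χ ∈ T`, the operator `T_χ T_χ̄` removes from `f` the part
with frequencies in the order interval `T \ χT = [1, χ)`. Thus `[T_χ, T_χ̄)` is `-1` on the
characters in `T \ χT`. If there are infinitely many of them, they form an infinite separated set
of unit vectors and the semicommutator is not compact (`finite_coneGap_of_isCompactOperator`). If
there are finitely many, the semicommutator is minus the projection onto their span, of finite
rank (`semicommutator_eq_neg_sum`). For `χ ∈ T`, having an index means that `T \ χT` is finite
(`mem_indexSet_iff`).

All the projections that occur are of the form `P_T (g + q)` with `g ∈ H^p(G)` and `q` a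
trigonometric polynomial. To evaluate them it suffices that `P_T` is closable and fixes `H^p(G)`.
Both follow from spectral synthesis in `L^p(G)`, `p < ∞` (`mem_closure_span_charLp`): a function
whose Fourier transform vanishes off a set `S` is a limit of trigonometric polynomials with
frequencies in `S`. By the Hahn–Banach theorem this reduces to the fact that a continuous function
with vanishing Fourier coefficients is zero, hence, by the Stone–Weierstrass theorem, to the fact
that characters separate the points of `G` (`exists_character_ne_one`). This part of the
Peter–Weyl theorem is proved in the usual way, from the spectral theorem for compact self-adjoint
operators (`exists_character_eigenvector`).

If all the intervals `[1, χ)` are finite, the ordered group `X` has a least positive element `g`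
and consists of its powers (`exists_zpow_of_finite_coneGap`). As characters separate points, `g :
G → 𝕋` is injective, and as `G` is connected, compact and nontrivial, it is onto
(`nonempty_continuousMulEquiv_circle`).
-/

noncomputable section

namespace OrderedToeplitz

set_option linter.unusedSectionVars false
set_option linter.overlappingInstances false

section Characters

/-! ### Characters separate the points of a compact abelian group -/

section PeterWeyl

open scoped InnerProductSpace

/-- For a continuous map `κ` from a compact space to a Hilbert space, the operator taking `v` to the
continuous function `x ↦ ⟪κ x, v⟫`. -/
def coefficientMap {K H : Type*} [TopologicalSpace K] [CompactSpace K] [NormedAddCommGroup H]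
    [InnerProductSpace ℂ H] (κ : C(K, H)) : H →L[ℂ] C(K, ℂ) :=
  LinearMap.mkContinuous
    { toFun v := ⟨fun x => ⟪κ x, v⟫_ℂ, by fun_prop⟩
      map_add' v w := by ext x; exact inner_add_right _ _ _
      map_smul' c v := by ext x; exact inner_smul_right _ _ _ } ‖κ‖ fun v => by
    refine (ContinuousMap.norm_le _ (by positivity)).2 fun x => ?_
    refine (norm_inner_le_norm (κ x) v).trans ?_
    gcongr
    exact κ.norm_coe_le_norm x

/-- The functions `x ↦ ⟪κ x, v⟫` with `‖v‖ ≤ 1` are bounded by `‖κ‖` and equicontinuous, so the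
Arzelà–Ascoli theorem applies. -/
theorem isCompactOperator_coefficientMap {K H : Type*} [TopologicalSpace K] [CompactSpace K]
    [NormedAddCommGroup H] [InnerProductSpace ℂ H] (κ : C(K, H)) :
    IsCompactOperator (coefficientMap κ) := by
  let e := ContinuousMap.isometryEquivBoundedOfCompact K ℂ
  let A : Set (BoundedContinuousFunction K ℂ) :=
    (fun v => e (coefficientMap κ v)) '' Metric.closedBall 0 1
  have hA : IsCompact (closure A) := by
    refine BoundedContinuousFunction.arzela_ascoli (Metric.closedBall (0 : ℂ) ‖κ‖)
      (isCompact_closedBall _ _) A ?_ ?_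
    · rintro _ x ⟨v, hv, rfl⟩
      rw [mem_closedBall_zero_iff] at hv ⊢
      refine (norm_inner_le_norm (κ x) v).trans ?_
      exact (mul_le_of_le_one_right (norm_nonneg _) hv).trans (κ.norm_coe_le_norm x)
    · intro x₀
      rw [Metric.equicontinuousAt_iff_right]
      intro ε hε
      filter_upwards [(κ.continuous.tendsto x₀).eventually (Metric.ball_mem_nhds _ hε)] with x hx
      rintro ⟨_, v, hv, rfl⟩
      rw [mem_closedBall_zero_iff] at hv
      change dist ⟪κ x₀, v⟫_ℂ ⟪κ x, v⟫_ℂ < ε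
      rw [dist_eq_norm, ← inner_sub_left]
      refine (norm_inner_le_norm _ _).trans_lt ?_
      refine (mul_le_of_le_one_right (norm_nonneg _) hv).trans_lt ?_
      rw [← dist_eq_norm, dist_comm]
      exact hx
  refine ⟨e.symm '' closure A, hA.image e.symm.continuous, ?_⟩
  refine Filter.mem_of_superset (Metric.closedBall_mem_nhds 0 one_pos) fun v hv => ?_
  exact ⟨_, subset_closure ⟨v, hv, rfl⟩, e.symm_apply_apply _⟩

/-- Commuting endomorphisms have a common eigenvector in every nonzero finite-dimensional
invariant subspace. -/
theorem exists_common_eigenvector {ι V : Type*} [AddCommGroup V] [Module ℂ V]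
    (S : ι → Module.End ℂ V) (hS : ∀ i j v, S i (S j v) = S j (S i v)) (E : Submodule ℂ V)
    [FiniteDimensional ℂ E] (hE : E ≠ ⊥) (hinv : ∀ i, ∀ v ∈ E, S i v ∈ E) :
    ∃ v ∈ E, v ≠ 0 ∧ ∀ i, ∃ c : ℂ, S i v = c • v := by
  induction hn : Module.finrank ℂ E using Nat.strong_induction_on generalizing E with
  | _ n ih =>
  subst hn
  by_cases hsc : ∀ i, ∃ c : ℂ, ∀ v ∈ E, S i v = c • v
  · obtain ⟨v, hv, hv0⟩ := E.ne_bot_iff.1 hE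
    exact ⟨v, hv, hv0, fun i => (hsc i).imp fun c hc => hc v hv⟩
  push Not at hsc
  obtain ⟨i, hi⟩ := hsc
  have : Nontrivial E := Submodule.nontrivial_iff_ne_bot.2 hE
  obtain ⟨c, hc⟩ := Module.End.exists_eigenvalue ((S i).restrict (hinv i))
  obtain ⟨w, hw⟩ := hc.exists_hasEigenvector
  have hw1 : S i w = c • (w : V) := congrArg Subtype.val hw.apply_eq_smul
  let E' : Submodule ℂ V := E ⊓ (S i).eigenspace c
  have hmem : ∀ v, v ∈ E' ↔ v ∈ E ∧ S i v = c • v := fun v => by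
    simp [E']
  have hlt : E' < E := by
    refine lt_of_le_of_ne inf_le_left fun h => ?_
    obtain ⟨v, hv, hv'⟩ := hi c
    exact hv' ((hmem v).1 (h ▸ hv)).2
  have : FiniteDimensional ℂ E' := Submodule.finiteDimensional_of_le hlt.le
  obtain ⟨v, hv, h⟩ := ih _ (Submodule.finrank_lt_finrank_of_lt hlt) E'
    (E'.ne_bot_iff.2 ⟨w, (hmem _).2 ⟨w.2, hw1⟩, by simpa using hw.2⟩) (fun j v hv => by
      rw [hmem] at hv ⊢
      exact ⟨hinv j v hv.1, by rw [hS, hv.2, map_smul]⟩) rfl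
  exact ⟨v, hlt.le hv, h⟩

theorem map_mul_apply {G H : Type*} [Monoid G] [NormedAddCommGroup H] [InnerProductSpace ℂ H]
    (U : G →* (H ≃ₗᵢ[ℂ] H)) (x y : G) (v : H) : U (x * y) v = U x (U y v) := by
  rw [map_mul, LinearIsometryEquiv.coe_mul, Function.comp_apply]

/-- The eigenvalues of a common eigenvector of a unitary representation form a character. -/
theorem exists_character_of_forall_eigenvector {G H : Type*} [CommGroup G] [TopologicalSpace G]
    [NormedAddCommGroup H]
    [InnerProductSpace ℂ H] (U : G →* (H ≃ₗᵢ[ℂ] H)) (hU : ∀ v, Continuous fun x => U x v)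
    {v : H} (hv : v ≠ 0) (h : ∀ x, ∃ c : ℂ, U x v = c • v) :
    ∃ χ : PontryaginDual G, ∀ x, U x v = (χ x : ℂ) • v := by
  choose c hc using h
  have hv' : ‖v‖ ≠ 0 := norm_ne_zero_iff.2 hv
  have hnorm : ∀ x, ‖c x‖ = 1 := fun x => by
    have := congrArg norm (hc x)
    rw [LinearIsometryEquiv.norm_map, norm_smul] at this
    exact mul_right_cancel₀ hv' (this.symm.trans (one_mul _).symm)
  have hmul : ∀ x y, c (x * y) = c x * c y := fun x y => by
    refine smul_left_injective ℂ hv ?_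
    simp only
    rw [← hc, map_mul_apply, hc y, map_smul, hc x, smul_smul, mul_comm]
  have hcont : Continuous c := by
    have : c = fun x => ⟪v, U x v⟫_ℂ / ⟪v, v⟫_ℂ := by
      ext x
      rw [hc, inner_smul_right, mul_div_cancel_right₀ _ (inner_self_ne_zero.2 hv)]
    rw [this]
    exact (continuous_const.inner (hU v)).div_const _
  let f : G →* Circle := MonoidHom.mk' (fun x => ⟨c x, mem_sphere_zero_iff_norm.2 (hnorm x)⟩)
    fun x y => Circle.ext (hmul x y)
  refine ⟨(⟨f, by exact hcont.subtype_mk _⟩ : G →ₜ* Circle), fun x => hc x⟩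

variable {G : Type*} [CommGroup G] [TopologicalSpace G] [IsTopologicalGroup G] [CompactSpace G]
  [MeasurableSpace G] [BorelSpace G]

/-- The operator taking `v` to the matrix coefficient `x ↦ ⟪U x f, v⟫` in `L²(G)`. It is compact,
vanishes only on the orthogonal complement of the orbit of `f`, and its Gram form is invariant
because it intertwines `U` with translation. -/
theorem exists_compact_intertwiner {H : Type*} [NormedAddCommGroup H]
    [InnerProductSpace ℂ H] (μ : Measure G) [μ.IsHaarMeasure]
    (U : G →* (H ≃ₗᵢ[ℂ] H)) (hU : ∀ v, Continuous fun x => U x v) (f : H) :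
    ∃ A : H →L[ℂ] Lp ℂ 2 μ, IsCompactOperator A ∧ (∀ v, A v = 0 ↔ ∀ x, ⟪U x f, v⟫_ℂ = 0) ∧
      ∀ x v w, ⟪A (U x v), A (U x w)⟫_ℂ = ⟪A v, A w⟫_ℂ := by
  obtain ⟨C, hCcpt, hC⟩ : ∃ C : H →L[ℂ] C(G, ℂ), IsCompactOperator C ∧
      ∀ v x, C v x = ⟪U x f, v⟫_ℂ :=
    ⟨coefficientMap ⟨fun x => U x f, hU f⟩, isCompactOperator_coefficientMap _, fun _ _ => rfl⟩
  have hCU : ∀ x v y, C (U x v) (x * y) = C v y := fun x v y => by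
    rw [hC, hC, map_mul_apply, LinearIsometryEquiv.inner_map_map]
  have hinner : ∀ v w, ⟪ContinuousMap.toLp 2 μ ℂ (C v), ContinuousMap.toLp 2 μ ℂ (C w)⟫_ℂ
      = ∫ x, ⟪C v x, C w x⟫_ℂ ∂μ := fun v w => by
    rw [L2.inner_def]
    refine integral_congr_ae ?_
    filter_upwards [ContinuousMap.coeFn_toLp (p := 2) (𝕜 := ℂ) μ (C v),
      ContinuousMap.coeFn_toLp (p := 2) (𝕜 := ℂ) μ (C w)] with x h1 h2
    rw [h1, h2]
  refine ⟨(ContinuousMap.toLp 2 μ ℂ).comp C, hCcpt.clm_comp (ContinuousMap.toLp 2 μ ℂ),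
    fun v => ?_, fun x v w => ?_⟩
  · rw [ContinuousLinearMap.comp_apply,
      map_eq_zero_iff _ (ContinuousMap.toLp_injective (p := 2) (𝕜 := ℂ) μ), ContinuousMap.ext_iff]
    simp [hC]
  · rw [ContinuousLinearMap.comp_apply, ContinuousLinearMap.comp_apply,
      ContinuousLinearMap.comp_apply, ContinuousLinearMap.comp_apply, hinner, hinner,
      ← integral_mul_left_eq_self _ x]
    simp only [hCU]

/-- A unitary representation is adjoint to its inverse. -/
theorem inner_map_left_eq {G H : Type*} [Group G] [NormedAddCommGroup H] [InnerProductSpace ℂ H]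
    (U : G →* (H ≃ₗᵢ[ℂ] H)) (x : G) (v w : H) : ⟪U x v, w⟫_ℂ = ⟪v, U x⁻¹ w⟫_ℂ := by
  rw [← LinearIsometryEquiv.inner_map_map (U x) v, ← map_mul_apply, mul_inv_cancel, map_one]
  rfl

/-- The operator `B = A† A`, with the two properties that characterize it. -/
theorem exists_compact_gram {H K : Type*} [NormedAddCommGroup H] [InnerProductSpace ℂ H]
    [CompleteSpace H] [NormedAddCommGroup K] [InnerProductSpace ℂ K] [CompleteSpace K]
    (A : H →L[ℂ] K) (hA : IsCompactOperator A) : ∃ B : H →L[ℂ] H, IsCompactOperator B ∧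
      (∀ v w, ⟪B v, w⟫_ℂ = ⟪A v, A w⟫_ℂ) ∧ ∀ v w, ⟪v, B w⟫_ℂ = ⟪A v, A w⟫_ℂ :=
  ⟨A.adjoint.comp A, hA.clm_comp A.adjoint,
    fun v w => ContinuousLinearMap.adjoint_inner_left A w (A v),
    fun v w => ContinuousLinearMap.adjoint_inner_right A v (A w)⟩

/-- The vectors on which `G` acts through a character are total in a unitary representation. With
`A v = (x ↦ ⟪U x f, v⟫)`, the operator `A† A` is compact, self-adjoint, nonzero, and commutes with
the representation, so that it has a nonzero eigenvalue whose eigenspace is finite-dimensional and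
invariant. -/
theorem exists_character_eigenvector {H : Type*} [NormedAddCommGroup H]
    [InnerProductSpace ℂ H] [CompleteSpace H] (μ : Measure G) [μ.IsHaarMeasure]
    (U : G →* (H ≃ₗᵢ[ℂ] H)) (hU : ∀ v, Continuous fun x => U x v) {f : H} (hf : f ≠ 0) :
    ∃ χ : PontryaginDual G, ∃ v, (∀ x, U x v = (χ x : ℂ) • v) ∧ ⟪f, v⟫_ℂ ≠ 0 := by
  obtain ⟨A, hAcpt, hA0, hAU⟩ := exists_compact_intertwiner μ U hU f
  obtain ⟨B, hBcpt, hB, hB'⟩ := exists_compact_gram A hAcpt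
  have hBsymm : B.IsSymmetric := fun v w => (hB v w).trans (hB' v w).symm
  have hB0 : B ≠ 0 := fun h => by
    have h1 : ⟪A f, A f⟫_ℂ = 0 := by rw [← hB, h]; simp
    have h2 := (hA0 f).1 (inner_self_eq_zero.1 h1) 1
    rw [map_one] at h2
    exact hf (inner_self_eq_zero.1 h2)
  have hBU : ∀ x v, B (U x v) = U x (B v) := fun x v => by
    refine ext_inner_right ℂ fun w => ?_
    rw [inner_map_left_eq, hB, hB, ← hAU x v, ← map_mul_apply, mul_inv_cancel, map_one]
    rfl
  obtain ⟨c, hc, hc0⟩ : ∃ c, Module.End.HasEigenvalue (B : Module.End ℂ H) c ∧ c ≠ 0 := by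
    by_contra! hcon
    exact hB0
      ((ContinuousLinearMap.eq_zero_of_forall_hasEigenvalue_eq_zero hBcpt hBsymm).1 hcon)
  have := ContinuousLinearMap.finite_dimensional_eigenspace hBcpt c hc0
  obtain ⟨v, hvE, hv0, hv⟩ := exists_common_eigenvector
    (fun x => ((U x).toLinearEquiv : H →ₗ[ℂ] H)) (fun x y v => by
      change U x (U y v) = U y (U x v)
      rw [← map_mul_apply, ← map_mul_apply, mul_comm])
    (Module.End.eigenspace (B : Module.End ℂ H) c) hc (fun x v hv => by
      rw [Module.End.mem_eigenspace_iff] at hv ⊢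
      change B v = c • v at hv
      change B (U x v) = c • U x v
      rw [hBU, hv, map_smul])
  rw [Module.End.mem_eigenspace_iff] at hvE
  change B v = c • v at hvE
  obtain ⟨χ, hχ⟩ := exists_character_of_forall_eigenvector U hU hv0 hv
  refine ⟨χ, v, hχ, fun h0 => ?_⟩
  have hAv : A v = 0 := (hA0 v).2 fun x => by
    rw [inner_map_left_eq, hχ, inner_smul_right, h0, mul_zero]
  have hBv : B v = 0 := ext_inner_right ℂ fun w => by
    rw [hB, hAv, inner_zero_left, inner_zero_left]
  exact smul_ne_zero hc0 hv0 (hvE.symm.trans hBv)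

end PeterWeyl

variable {G : Type*} [CommGroup G] [TopologicalSpace G] [IsTopologicalGroup G] [CompactSpace G]
  [MeasurableSpace G] [BorelSpace G]

/-- The action of `G` on `L²(G)` by translations, `f ↦ (y ↦ f (x * y))`; this is a homomorphism
because `G` is commutative. -/
def regularRep (μ : Measure G) [μ.IsHaarMeasure] : G →* (Lp ℂ 2 μ ≃ₗᵢ[ℂ] Lp ℂ 2 μ) :=
  MonoidHom.mk' (fun x =>
    { DistribMulAction.toLinearEquiv ℂ (Lp ℂ 2 μ) (DomMulAct.mk x) with
      norm_map' := fun f => DomMulAct.norm_smul_Lp _ f }) fun x y => by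
    ext1 f
    change DomMulAct.mk (x * y) • f = DomMulAct.mk x • DomMulAct.mk y • f
    rw [mul_comm, DomMulAct.mk_mul, mul_smul]

theorem regularRep_apply (μ : Measure G) [μ.IsHaarMeasure] (x : G) (f : Lp ℂ 2 μ) :
    regularRep μ x f = DomMulAct.mk x • f := rfl

theorem mk_smul_toLp_continuousMap {p : ℝ≥0∞} [Fact (1 ≤ p)] (μ : Measure G) [μ.IsHaarMeasure]
    (x : G) (u : C(G, ℂ)) :
    DomMulAct.mk x • ContinuousMap.toLp p μ ℂ u =
      ContinuousMap.toLp p μ ℂ (u.comp (ContinuousMap.mulLeft x)) := by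
  refine Lp.ext ?_
  have h := (measurePreserving_mul_left μ x).quasiMeasurePreserving.ae
    (ContinuousMap.coeFn_toLp (p := p) (𝕜 := ℂ) μ u)
  filter_upwards [DomMulAct.smul_Lp_ae_eq (DomMulAct.mk x) (ContinuousMap.toLp p μ ℂ u), h,
    ContinuousMap.coeFn_toLp (p := p) (𝕜 := ℂ) μ (u.comp (ContinuousMap.mulLeft x))]
    with y h1 h2 h3
  rw [h1, h3]
  exact h2

/-- Apply `exists_character_eigenvector` to the difference of a function `u` and its translate by
`a`: a vector on which `G` acts by a character with value `1` at `a` is orthogonal to it. -/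
theorem exists_character_ne_one [T2Space G] {a : G} (ha : a ≠ 1) :
    ∃ χ : PontryaginDual G, χ a ≠ 1 := by
  let μ : Measure G := Measure.haarMeasure ⊤
  obtain ⟨u₀, hu1, hua, -⟩ := exists_continuous_zero_one_of_isClosed
    (isClosed_singleton (x := (1 : G))) (isClosed_singleton (x := a)) (by simpa using ha.symm)
  let u : C(G, ℂ) := ⟨fun x => (u₀ x : ℂ), by fun_prop⟩
  let F : Lp ℂ 2 μ := ContinuousMap.toLp 2 μ ℂ u
  have hF : F - regularRep μ a F ≠ 0 := fun h => by
    rw [regularRep_apply, mk_smul_toLp_continuousMap, sub_eq_zero] at h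
    have h1 := DFunLike.congr_fun (ContinuousMap.toLp_injective (p := 2) (𝕜 := ℂ) μ h) 1
    have h2 : (u₀ 1 : ℂ) = u₀ (a * 1) := h1
    rw [mul_one, hu1 rfl, hua rfl] at h2
    simp at h2
  have : Fact ((2 : ℝ≥0∞) ≠ ∞) := ⟨by simp⟩
  have hcont : ∀ v : Lp ℂ 2 μ, Continuous fun x => regularRep μ x v := fun v =>
    (DomMulAct.continuous_mk (M := G)).smul continuous_const
  obtain ⟨χ, v, hv, hne⟩ := exists_character_eigenvector μ (regularRep μ) hcont hF
  refine ⟨χ, fun hχ => hne ?_⟩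
  rw [inner_sub_left, inner_map_left_eq, hv, map_inv, hχ, inv_one, Circle.coe_one, one_smul,
    sub_self]

end Characters

section Density

/-! ### Density of the trigonometric polynomials and spectral synthesis -/

variable {G : Type*} [CommGroup G] [TopologicalSpace G] [IsTopologicalGroup G] [CompactSpace G]
  [MeasurableSpace G] [BorelSpace G]

/-- The star algebra of trigonometric polynomials. -/
def trigPolynomials (G : Type*) [CommGroup G] [TopologicalSpace G] [IsTopologicalGroup G]
    [CompactSpace G] : StarSubalgebra ℂ C(G, ℂ) where
  toSubalgebra := Algebra.adjoin ℂ (Set.range (charFun (G := G)))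
  star_mem' := by
    change Algebra.adjoin ℂ (Set.range (charFun (G := G))) ≤
      star (Algebra.adjoin ℂ (Set.range (charFun (G := G))))
    refine Algebra.adjoin_le ?_
    rintro - ⟨χ, rfl⟩
    exact Algebra.subset_adjoin ⟨χ⁻¹, ContinuousMap.ext fun x => Circle.coe_inv_eq_conj _⟩

theorem trigPolynomials_eq_span :
    Subalgebra.toSubmodule (trigPolynomials G).toSubalgebra =
      Submodule.span ℂ (Set.range (charFun (G := G))) := by
  refine Algebra.adjoin_eq_span_of_subset ℂ ?_
  refine Set.Subset.trans ?_ Submodule.subset_span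
  intro x hx
  refine Submonoid.closure_induction (fun _ => id) ⟨1, rfl⟩ ?_ hx
  rintro - - - - ⟨χ, rfl⟩ ⟨ξ, rfl⟩
  exact ⟨χ * ξ, ContinuousMap.ext fun x => Circle.coe_mul _ _⟩

theorem span_charFun_closure_eq_top [T2Space G] :
    (Submodule.span ℂ (Set.range (charFun (G := G)))).topologicalClosure = ⊤ := by
  rw [← trigPolynomials_eq_span]
  refine congrArg (Subalgebra.toSubmodule <| StarSubalgebra.toSubalgebra ·)
    (ContinuousMap.starSubalgebra_topologicalClosure_eq_top_of_separatesPoints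
      (trigPolynomials G) ?_)
  intro x y hxy
  obtain ⟨χ, hχ⟩ := exists_character_ne_one (a := x * y⁻¹) (by rwa [Ne, mul_inv_eq_one])
  refine ⟨_, ⟨charFun χ, Algebra.subset_adjoin ⟨χ, rfl⟩, rfl⟩, fun h => hχ ?_⟩
  rw [map_mul, map_inv, mul_inv_eq_one]
  exact Circle.ext h

variable (p : ℝ≥0∞) [Fact (1 ≤ p)] (μ : Measure G) [μ.IsHaarMeasure]

theorem dense_span_charLp [T2Space G] [μ.Regular] (hp : p ≠ ∞) :
    Dense (Submodule.span ℂ (Set.range (charLp (G := G) p μ)) : Set (Lp ℂ p μ)) := by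
  have h1 : Dense (Submodule.span ℂ (Set.range (charFun (G := G))) : Set C(G, ℂ)) :=
    (Submodule.dense_iff_topologicalClosure_eq_top).2 span_charFun_closure_eq_top
  have h2 := (ContinuousMap.toLp_denseRange ℂ μ ℂ hp).dense_image
    (ContinuousMap.toLp p μ ℂ : C(G, ℂ) →L[ℂ] Lp ℂ p μ).continuous h1
  refine h2.mono ?_
  rw [show Set.range (charLp (G := G) p μ) =
    (ContinuousMap.toLp p μ ℂ : C(G, ℂ) →L[ℂ] Lp ℂ p μ) '' Set.range charFun from
    (Set.range_comp _ _)]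
  exact (Submodule.map_span (ContinuousMap.toLp p μ ℂ : C(G, ℂ) →L[ℂ] Lp ℂ p μ).toLinearMap
    (Set.range charFun)).le

variable {p} in
theorem charLp_coeFn (χ : PontryaginDual G) : charLp p μ χ =ᵐ[μ] fun x => (χ x : ℂ) :=
  ContinuousMap.coeFn_toLp (p := p) (𝕜 := ℂ) μ (charFun χ)

theorem fourierCoef_congr {f g : G → ℂ} (h : f =ᵐ[μ] g) (χ : PontryaginDual G) :
    fourierCoef μ f χ = fourierCoef μ g χ :=
  integral_congr_ae (h.mono fun x hx => by simp only [hx])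

theorem fourierCoef_add (f g : Lp ℂ p μ) (χ : PontryaginDual G) :
    fourierCoef μ (f + g : Lp ℂ p μ) χ = fourierCoef μ f χ + fourierCoef μ g χ := by
  rw [fourierCoef_congr μ (Lp.coeFn_add f g)]
  simp only [fourierCoef, Pi.add_apply, add_mul]
  exact integral_add (integrable_mul_star_char f χ) (integrable_mul_star_char g χ)

theorem fourierCoef_smul (c : ℂ) (f : Lp ℂ p μ) (χ : PontryaginDual G) :
    fourierCoef μ (c • f : Lp ℂ p μ) χ = c * fourierCoef μ f χ := by
  rw [fourierCoef_congr μ (Lp.coeFn_smul c f)]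
  simp only [fourierCoef, Pi.smul_apply, smul_eq_mul, mul_assoc]
  exact integral_const_mul _ _

theorem norm_fourierCoef_le [IsProbabilityMeasure μ] (f : Lp ℂ p μ) (χ : PontryaginDual G) :
    ‖fourierCoef μ f χ‖ ≤ ‖f‖ := by
  have h1 : ‖fourierCoef μ f χ‖ ≤ ∫ x, ‖f x‖ ∂μ := by
    refine (norm_integral_le_integral_norm _).trans (le_of_eq ?_)
    refine integral_congr_ae (Filter.Eventually.of_forall fun x => ?_)
    simp only [norm_mul, norm_star, Circle.norm_coe, mul_one]
  refine h1.trans ?_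
  rw [integral_norm_eq_lintegral_enorm (Lp.aestronglyMeasurable f),
    ← eLpNorm_one_eq_lintegral_enorm, Lp.norm_def]
  exact ENNReal.toReal_mono (Lp.eLpNorm_ne_top f)
    (eLpNorm_le_eLpNorm_of_exponent_le Fact.out (Lp.aestronglyMeasurable f))

/-- The Fourier coefficient at `χ` as a continuous linear functional on `L^p(G)`. -/
def fourierCoefCLM [IsProbabilityMeasure μ] (χ : PontryaginDual G) : Lp ℂ p μ →L[ℂ] ℂ :=
  LinearMap.mkContinuous
    { toFun f := fourierCoef μ f χ
      map_add' f g := fourierCoef_add p μ f g χ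
      map_smul' c f := fourierCoef_smul p μ c f χ } 1 fun f => by
    rw [one_mul]
    exact norm_fourierCoef_le p μ f χ

@[simp]
theorem fourierCoefCLM_apply [IsProbabilityMeasure μ] (χ : PontryaginDual G) (f : Lp ℂ p μ) :
    fourierCoefCLM p μ χ f = fourierCoef μ f χ := rfl

theorem fourierCoef_charLp_self [IsProbabilityMeasure μ] (χ : PontryaginDual G) :
    fourierCoef μ (charLp p μ χ) χ = 1 := by
  have : fourierCoef μ (charLp p μ χ) χ = ∫ x, (1 : ℂ) ∂μ := by
    refine integral_congr_ae ?_
    filter_upwards [charLp_coeFn (p := p) μ χ] with x hx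
    rw [hx]
    change (χ x : ℂ) * (starRingEnd ℂ) (χ x : ℂ) = 1
    rw [← Circle.coe_inv_eq_conj, ← Circle.coe_mul, mul_inv_cancel, Circle.coe_one]
  rw [this]
  simp

open scoped InnerProductSpace in
/-- A continuous function is determined by its Fourier coefficients. -/
theorem eq_zero_of_fourierCoef_eq_zero [T2Space G] [μ.Regular] {h : C(G, ℂ)}
    (h0 : ∀ χ, fourierCoef μ h χ = 0) : h = 0 := by
  have key : ContinuousMap.toLp 2 μ ℂ h = 0 := by
    refine (dense_span_charLp 2 μ (by simp)).eq_zero_of_inner_right (𝕜 := ℂ) fun v hv => ?_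
    rw [SetLike.mem_coe] at hv
    induction hv using Submodule.span_induction with
    | mem v hv =>
      obtain ⟨χ, rfl⟩ := hv
      rw [L2.inner_def, ← h0 χ]
      refine integral_congr_ae ?_
      filter_upwards [charLp_coeFn (p := 2) μ χ,
        ContinuousMap.coeFn_toLp (p := 2) (𝕜 := ℂ) μ h] with x h1 h2
      rw [h1, h2]
      rfl
    | zero => simp
    | add v w _ _ hv hw => rw [inner_add_left, hv, hw, add_zero]
    | smul c v _ hv => rw [inner_smul_left, hv, mul_zero]
  exact ContinuousMap.toLp_injective (p := 2) (𝕜 := ℂ) μ (key.trans (map_zero _).symm)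

/-- For a functional `ℓ` on `L^p(G)`, the operator taking `f` to the continuous function
`y ↦ ℓ (τ_y f)`, where `τ_y` is the translation by `y`. -/
def orbitMap [T2Space G] [μ.Regular] [Fact (p ≠ ∞)] (ℓ : Lp ℂ p μ →L[ℂ] ℂ) :
    Lp ℂ p μ →L[ℂ] C(G, ℂ) :=
  LinearMap.mkContinuous
    { toFun f := ⟨fun y => ℓ (DomMulAct.mk y • f),
        ℓ.continuous.comp (DomMulAct.continuous_mk.smul continuous_const)⟩
      map_add' f g := by ext y; simp [smul_add]
      map_smul' c f := by ext y; simp [smul_comm _ c f] } ‖ℓ‖ fun f => by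
    refine (ContinuousMap.norm_le _ (by positivity)).2 fun y => ?_
    refine (ℓ.le_opNorm _).trans_eq ?_
    rw [DomMulAct.norm_smul_Lp]

theorem orbitMap_apply [T2Space G] [μ.Regular] [Fact (p ≠ ∞)] (ℓ : Lp ℂ p μ →L[ℂ] ℂ)
    (f : Lp ℂ p μ) (y : G) : orbitMap p μ ℓ f y = ℓ (DomMulAct.mk y • f) := rfl

theorem mk_smul_charLp (y : G) (χ : PontryaginDual G) :
    DomMulAct.mk y • charLp p μ χ = (χ y : ℂ) • charLp p μ χ := by
  rw [charLp, mk_smul_toLp_continuousMap, ← map_smul]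
  congr 1
  ext x
  change ((χ (y * x) : Circle) : ℂ) = (χ y : ℂ) * (χ x : ℂ)
  rw [map_mul, Circle.coe_mul]

/-- Both sides are continuous in `f`, so that it suffices to compare them on characters. -/
theorem fourierCoef_orbitMap [T2Space G] [μ.Regular] [IsProbabilityMeasure μ] [Fact (p ≠ ∞)]
    (ℓ : Lp ℂ p μ →L[ℂ] ℂ) (f : Lp ℂ p μ) (χ : PontryaginDual G) :
    fourierCoef μ (orbitMap p μ ℓ f) χ = fourierCoef μ f χ * ℓ (charLp p μ χ) := by
  let Φ : Lp ℂ p μ →L[ℂ] ℂ :=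
    (fourierCoefCLM 1 μ χ).comp ((ContinuousMap.toLp 1 μ ℂ).comp (orbitMap p μ ℓ))
  have hΦ : ∀ f, Φ f = fourierCoef μ (orbitMap p μ ℓ f) χ := fun f =>
    fourierCoef_congr μ (ContinuousMap.coeFn_toLp (p := 1) (𝕜 := ℂ) μ _) χ
  have hext : Φ = ℓ (charLp p μ χ) • fourierCoefCLM p μ χ := by
    refine ContinuousLinearMap.ext_on (dense_span_charLp p μ Fact.out) ?_
    rintro _ ⟨ξ, rfl⟩
    have h1 : fourierCoef μ (orbitMap p μ ℓ (charLp p μ ξ)) χ =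
        ℓ (charLp p μ ξ) * fourierCoef μ (charLp p μ ξ) χ := by
      rw [fourierCoef_congr μ (charLp_coeFn (p := p) μ ξ)]
      simp only [fourierCoef, orbitMap_apply, mk_smul_charLp, map_smul, smul_eq_mul]
      rw [← integral_const_mul]
      congr 1
      ext x
      ring
    rw [hΦ, h1]
    change _ = ℓ (charLp p μ χ) * fourierCoef μ (charLp p μ ξ) χ
    by_cases h : ξ = χ
    · rw [h]
    · rw [fourierCoef_charLp h, mul_zero, mul_zero]
  rw [← hΦ, hext, mul_comm]
  rfl

/-- Spectral synthesis: a function whose Fourier transform vanishes off `S` is approximated by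
trigonometric polynomials with frequencies in `S`. If a functional `ℓ` vanishes at the characters
in `S`, all Fourier coefficients of `y ↦ ℓ (τ_y f)` vanish, so `ℓ f = 0`. -/
theorem mem_closure_span_charLp [T2Space G] [μ.Regular] [IsProbabilityMeasure μ] (hp : p ≠ ∞)
    {S : Set (PontryaginDual G)} {f : Lp ℂ p μ} (hf : ∀ χ, χ ∉ S → fourierCoef μ f χ = 0) :
    f ∈ (Submodule.span ℂ (charLp p μ '' S)).topologicalClosure := by
  have : Fact (p ≠ ∞) := ⟨hp⟩
  by_contra hcon
  let V := (Submodule.span ℂ (charLp p μ '' S)).topologicalClosure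
  have : IsClosed (V : Set (Lp ℂ p μ)) := Submodule.isClosed_topologicalClosure _
  have hq : V.mkQL f ≠ 0 := fun h => hcon ((Submodule.Quotient.mk_eq_zero V).1 h)
  obtain ⟨g, hg⟩ := SeparatingDual.exists_ne_zero (R := ℂ) hq
  let ℓ : Lp ℂ p μ →L[ℂ] ℂ := g.comp V.mkQL
  have hℓ : ∀ χ ∈ S, ℓ (charLp p μ χ) = 0 := fun χ hχ => by
    have : V.mkQL (charLp p μ χ) = 0 := (Submodule.Quotient.mk_eq_zero V).2
      (Submodule.le_topologicalClosure _ (Submodule.subset_span ⟨χ, hχ, rfl⟩))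
    simp only [ℓ, ContinuousLinearMap.comp_apply, this, map_zero]
  have h0 : orbitMap p μ ℓ f = 0 := eq_zero_of_fourierCoef_eq_zero μ fun χ => by
    rw [fourierCoef_orbitMap]
    by_cases hχ : χ ∈ S
    · rw [hℓ χ hχ, mul_zero]
    · rw [hf χ hχ, zero_mul]
  have h1 := DFunLike.congr_fun h0 1
  rw [orbitMap_apply, DomMulAct.mk_one, one_smul] at h1
  exact hg h1

/-- A function in `L^p(G)` is determined by its Fourier coefficients. -/
theorem Lp_eq_zero_of_fourierCoef_eq_zero [T2Space G] [μ.Regular] [IsProbabilityMeasure μ]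
    (hp : p ≠ ∞) {f : Lp ℂ p μ} (hf : ∀ χ, fourierCoef μ f χ = 0) : f = 0 := by
  have := mem_closure_span_charLp p μ hp (S := ∅) fun χ _ => hf χ
  rw [Set.image_empty, Submodule.span_empty] at this
  simpa [← SetLike.mem_coe, Submodule.topologicalClosure_coe] using this

end Density

section RieszProjection

/-! ### The Riesz projection and Toeplitz operators on functions with known spectrum -/

variable {G : Type*} [CommGroup G] [TopologicalSpace G] [IsTopologicalGroup G] [CompactSpace G]
  [MeasurableSpace G] [BorelSpace G]

section Toeplitz

variable {p : ℝ≥0∞} [Fact (1 ≤ p)] {μ : Measure G} [μ.IsHaarMeasure] [IsProbabilityMeasure μ]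
  {T : Submonoid (PontryaginDual G)}

theorem coe_rieszChar {χ : PontryaginDual G} (h : χ ∈ T) :
    (rieszChar p μ T χ : Lp ℂ p μ) = charLp p μ χ :=
  congrArg Subtype.val (dif_pos h)

theorem rieszChar_of_notMem {χ : PontryaginDual G} (h : χ ∉ T) : rieszChar p μ T χ = 0 :=
  dif_neg h

/-- On the closure of the graph of the Riesz projection, `(P f)^ = f^` on `T`; this holds for pairs
of trigonometric polynomials, and Fourier coefficients are continuous. -/
theorem fourierCoef_eq_of_mem_closure {x : Lp ℂ p μ × hardy p μ T}
    (hx : x ∈ (rieszPolGraph p μ T).topologicalClosure) {χ : PontryaginDual G} (hχ : χ ∈ T) :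
    fourierCoef μ (x.2 : Lp ℂ p μ) χ = fourierCoef μ x.1 χ := by
  let Φ : Lp ℂ p μ × hardy p μ T →L[ℂ] ℂ :=
    (fourierCoefCLM p μ χ).comp ((hardy p μ T).subtypeL.comp (ContinuousLinearMap.snd ℂ _ _)) -
      (fourierCoefCLM p μ χ).comp (ContinuousLinearMap.fst ℂ _ _)
  have hle : (rieszPolGraph p μ T).topologicalClosure ≤ LinearMap.ker Φ.toLinearMap := by
    refine Submodule.topologicalClosure_minimal _ ?_ Φ.isClosed_ker
    rw [rieszPolGraph, LinearMap.range_le_ker_iff]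
    refine Finsupp.lhom_ext' fun ξ => LinearMap.ext_ring ?_
    change Φ (Finsupp.linearCombination ℂ (charLp p μ) (Finsupp.single ξ 1),
      Finsupp.linearCombination ℂ (rieszChar p μ T) (Finsupp.single ξ 1)) = 0
    rw [Finsupp.linearCombination_single, Finsupp.linearCombination_single, one_smul, one_smul]
    change fourierCoef μ (rieszChar p μ T ξ : Lp ℂ p μ) χ - fourierCoef μ (charLp p μ ξ) χ = 0
    rw [sub_eq_zero]
    by_cases h : ξ ∈ T
    · rw [coe_rieszChar h]
    · rw [rieszChar_of_notMem h, fourierCoef_charLp fun e : ξ = χ => h (e ▸ hχ)]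
      exact (fourierCoefCLM p μ χ).map_zero
  exact sub_eq_zero.1 (hle hx)

variable [T2Space G] [μ.Regular]

/-- The Riesz projection on trigonometric polynomials is closable. -/
theorem snd_eq_zero_of_mem_closure (hp : p ≠ ∞) (x : Lp ℂ p μ × hardy p μ T)
    (hx : x ∈ (rieszPolGraph p μ T).topologicalClosure) (h0 : x.1 = 0) : x.2 = 0 := by
  refine Subtype.ext (Lp_eq_zero_of_fourierCoef_eq_zero p μ hp fun χ => ?_)
  by_cases hχ : χ ∈ T
  · rw [fourierCoef_eq_of_mem_closure hx hχ, h0]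
    exact (fourierCoefCLM p μ χ).map_zero
  · exact x.2.2 χ hχ

/-- The Toeplitz operator, where `φ f` is known to be in the domain of the Riesz projection. -/
theorem toeplitz_eq_of_mem_closure (hp : p ≠ ∞) {φ : Lp ℂ ∞ μ} {f g : hardy p μ T}
    (h : ((φ • (f : Lp ℂ p μ) : Lp ℂ p μ), g) ∈ (rieszPolGraph p μ T).topologicalClosure) :
    toeplitz p μ T φ f = g := by
  have h1 : ((φ • (f : Lp ℂ p μ) : Lp ℂ p μ), g) ∈ (rieszProj p μ T).graph := by
    rw [rieszProj, Submodule.toLinearPMap_graph_eq _ (snd_eq_zero_of_mem_closure hp)]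
    exact h
  obtain ⟨y, hy1, hy2⟩ := (LinearPMap.mem_graph_iff _).1 h1
  simp only at hy1 hy2
  have hdom : (φ • (f : Lp ℂ p μ) : Lp ℂ p μ) ∈ (rieszProj p μ T).domain := hy1 ▸ y.2
  rw [toeplitz, dif_pos hdom, ← hy2]
  congr 1
  exact Subtype.ext hy1.symm

theorem char_rieszChar_mem_closure (χ : PontryaginDual G) :
    (charLp p μ χ, rieszChar p μ T χ) ∈ (rieszPolGraph p μ T).topologicalClosure := by
  refine Submodule.le_topologicalClosure _ ⟨Finsupp.single χ 1, ?_⟩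
  simp

/-- The Riesz projection fixes the Hardy space, in which the trigonometric polynomials with
frequencies in `T` are dense by spectral synthesis. -/
theorem self_mem_closure (hp : p ≠ ∞) (g : hardy p μ T) :
    ((g : Lp ℂ p μ), g) ∈ (rieszPolGraph p μ T).topologicalClosure := by
  let J : hardy p μ T →L[ℂ] Lp ℂ p μ × hardy p μ T :=
    (hardy p μ T).subtypeL.prod (ContinuousLinearMap.id ℂ _)
  let D : Submodule ℂ (hardy p μ T) :=
    (rieszPolGraph p μ T).topologicalClosure.comap J.toLinearMap
  have hDcl : IsClosed (D : Set (hardy p μ T)) :=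
    (Submodule.isClosed_topologicalClosure _).preimage J.continuous
  have hD : Submodule.span ℂ (charLp p μ '' (T : Set (PontryaginDual G))) ≤
      D.map (hardy p μ T).subtype := by
    rw [Submodule.span_le]
    rintro _ ⟨χ, hχ, rfl⟩
    refine ⟨rieszChar p μ T χ, ?_, coe_rieszChar hχ⟩
    change ((rieszChar p μ T χ : Lp ℂ p μ), rieszChar p μ T χ) ∈
      (rieszPolGraph p μ T).topologicalClosure
    rw [coe_rieszChar hχ]
    exact char_rieszChar_mem_closure χ
  have hg : (g : Lp ℂ p μ) ∈ closure ((D.map (hardy p μ T).subtype : Submodule ℂ (Lp ℂ p μ)) :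
      Set (Lp ℂ p μ)) :=
    closure_mono hD (mem_closure_span_charLp p μ hp g.2)
  have : g ∈ closure (D : Set (hardy p μ T)) := closure_subtype.2 hg
  rwa [hDcl.closure_eq] at this

end Toeplitz

section Symbol

variable {p : ℝ≥0∞} [Fact (1 ≤ p)] {μ : Measure G} [μ.IsHaarMeasure] [IsProbabilityMeasure μ]
  {T : Submonoid (PontryaginDual G)}

theorem fourierCoef_charLp_smul (χ ξ : PontryaginDual G) (f : Lp ℂ p μ) :
    fourierCoef μ (charLp ∞ μ χ • f : Lp ℂ p μ) ξ = fourierCoef μ f (χ⁻¹ * ξ) := by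
  refine integral_congr_ae ?_
  filter_upwards [Lp.coeFn_lpSMul (r := p) (charLp ∞ μ χ) f, charLp_coeFn (p := ∞) μ χ]
    with x h1 h2
  rw [h1, Pi.smul_apply', h2, smul_eq_mul]
  change _ = f x * star (((χ x)⁻¹ * ξ x : Circle) : ℂ)
  rw [Circle.coe_mul, Circle.coe_inv_eq_conj, star_mul, ← starRingEnd_apply (starRingEnd ℂ _),
    Complex.conj_conj]
  ring

theorem charLp_smul_charLp (χ ξ : PontryaginDual G) :
    (charLp ∞ μ χ • charLp p μ ξ : Lp ℂ p μ) = charLp p μ (χ * ξ) := by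
  refine Lp.ext ?_
  filter_upwards [Lp.coeFn_lpSMul (r := p) (charLp ∞ μ χ) (charLp p μ ξ),
    charLp_coeFn (p := ∞) μ χ, charLp_coeFn (p := p) μ ξ, charLp_coeFn (p := p) μ (χ * ξ)]
    with x h1 h2 h3 h4
  rw [h1, Pi.smul_apply', h2, h3, h4, smul_eq_mul, ← Circle.coe_mul]
  rfl

theorem star_charLp (χ : PontryaginDual G) : star (charLp p μ χ) = charLp p μ χ⁻¹ := by
  refine Lp.ext ?_
  filter_upwards [Lp.coeFn_star (charLp p μ χ), charLp_coeFn (p := p) μ χ,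
    charLp_coeFn (p := p) μ χ⁻¹] with x h1 h2 h3
  rw [h1, Pi.star_apply, h2, h3]
  exact (Circle.coe_inv_eq_conj _).symm

theorem charLp_smul_smul (χ ξ : PontryaginDual G) (f : Lp ℂ p μ) :
    (charLp ∞ μ χ • (charLp ∞ μ ξ • f : Lp ℂ p μ) : Lp ℂ p μ) = charLp ∞ μ (χ * ξ) • f := by
  refine Lp.ext ?_
  filter_upwards [Lp.coeFn_lpSMul (r := p) (charLp ∞ μ χ) (charLp ∞ μ ξ • f : Lp ℂ p μ),
    Lp.coeFn_lpSMul (r := p) (charLp ∞ μ ξ) f, Lp.coeFn_lpSMul (r := p) (charLp ∞ μ (χ * ξ)) f,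
    charLp_coeFn (p := ∞) μ χ, charLp_coeFn (p := ∞) μ ξ, charLp_coeFn (p := ∞) μ (χ * ξ)]
    with x h1 h2 h3 h4 h5 h6
  rw [h1, Pi.smul_apply', h2, Pi.smul_apply', h3, Pi.smul_apply', h4, h5, h6, smul_smul,
    smul_eq_mul, smul_eq_mul, ← Circle.coe_mul]
  rfl

theorem charLp_one_smul (f : Lp ℂ p μ) : (charLp ∞ μ 1 • f : Lp ℂ p μ) = f := by
  refine Lp.ext ?_
  filter_upwards [Lp.coeFn_lpSMul (r := p) (charLp ∞ μ 1) f, charLp_coeFn (p := ∞) μ 1]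
    with x h1 h2
  rw [h1, Pi.smul_apply', h2, PontryaginDual.one_apply, Circle.coe_one, one_smul]

end Symbol

end RieszProjection

section Semicommutator

/-! ### Compactness of the semicommutators -/

section Cone

variable {X : Type*} [CommGroup X] {T : Submonoid X}

theorem mem_coneGap {χ ξ : X} : ξ ∈ coneGap T χ ↔ ξ ∈ T ∧ χ⁻¹ * ξ ∉ T := by
  refine and_congr Iff.rfl (not_congr ⟨?_, fun h => ⟨_, h, mul_inv_cancel_left _ _⟩⟩)
  rintro ⟨η, hη, rfl⟩
  simpa using hη

/-- If `χ = χ₁χ₂⁻¹` with `χ₂ ∈ T`, then `χ₁T ⊆ χT`. -/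
theorem mem_indexSet_iff {χ : X} (hχ : χ ∈ T) : χ ∈ indexSet T ↔ (coneGap T χ).Finite := by
  refine ⟨?_, fun h => Or.inl ⟨hχ, h⟩⟩
  rintro (h | ⟨χ₁, -, χ₂, h₂, rfl, hfin, -⟩)
  · exact h.2
  · refine hfin.subset fun ξ hξ => ?_
    rw [mem_coneGap] at hξ ⊢
    refine ⟨hξ.1, fun h => hξ.2 ?_⟩
    have := T.mul_mem h₂ h
    rwa [mul_inv_rev, inv_inv, mul_assoc]

end Cone

variable {G : Type*} [CommGroup G] [TopologicalSpace G] [IsTopologicalGroup G] [CompactSpace G]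
  [T2Space G] [MeasurableSpace G] [BorelSpace G]
  {p : ℝ≥0∞} [Fact (1 ≤ p)] {μ : Measure G} [μ.IsHaarMeasure] [μ.Regular] [IsProbabilityMeasure μ]
  {T : Submonoid (PontryaginDual G)}

theorem toeplitz_charLp_one (hp : p ≠ ∞) (f : hardy p μ T) : toeplitz p μ T (charLp ∞ μ 1) f = f :=
  toeplitz_eq_of_mem_closure hp (by rw [charLp_one_smul]; exact self_mem_closure hp f)

theorem semicommutator_eq (hp : p ≠ ∞) (χ : PontryaginDual G) (f : hardy p μ T) :
    semicommutator p μ T (charLp ∞ μ χ) (star (charLp ∞ μ χ)) f =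
      toeplitz p μ T (charLp ∞ μ χ) (toeplitz p μ T (charLp ∞ μ χ⁻¹) f) - f := by
  rw [semicommutator, star_charLp, charLp_smul_charLp, mul_inv_cancel, toeplitz_charLp_one hp]

/-- If `φ f ∈ H^p(G)`, then the Riesz projection fixes it. -/
theorem toeplitz_eq_of_smul_eq (hp : p ≠ ∞) {φ : Lp ℂ ∞ μ} {f g : hardy p μ T}
    (h : (φ • (f : Lp ℂ p μ) : Lp ℂ p μ) = g) : toeplitz p μ T φ f = g :=
  toeplitz_eq_of_mem_closure hp (by rw [h]; exact self_mem_closure hp g)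

theorem fourierCoef_sum_charLp (s : Finset (PontryaginDual G)) (c : PontryaginDual G → ℂ)
    (η : PontryaginDual G) [Decidable (η ∈ s)] :
    fourierCoef μ (∑ ξ ∈ s, c ξ • charLp p μ ξ : Lp ℂ p μ) η = if η ∈ s then c η else 0 := by
  classical
  rw [← fourierCoefCLM_apply, map_sum]
  have : ∀ ξ, fourierCoefCLM p μ η (c ξ • charLp p μ ξ) = if η = ξ then c ξ else 0 := fun ξ => by
    rw [map_smul, fourierCoefCLM_apply, smul_eq_mul]
    split_ifs with h
    · rw [h, fourierCoef_charLp_self, mul_one]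
    · rw [fourierCoef_charLp (Ne.symm h), mul_zero]
  simp only [this, Finset.sum_ite_eq]
  congr

/-- When `T \ χT` is finite, the semicommutator is minus the projection onto the span of the
characters in `T \ χT`: if `q` is the part of `f` with frequencies in `T \ χT`, then
`T_χ̄ f = χ̄ (f - q)`, which `T_χ` takes to `f - q`. -/
theorem semicommutator_eq_neg_sum (hp : p ≠ ∞) {χ : PontryaginDual G}
    (hfin : (coneGap T χ).Finite) (f : hardy p μ T) :
    semicommutator p μ T (charLp ∞ μ χ) (star (charLp ∞ μ χ)) f =
      -∑ ξ ∈ hfin.toFinset, fourierCoef μ (f : Lp ℂ p μ) ξ • rieszChar p μ T ξ := by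
  classical
  set q : hardy p μ T :=
    ∑ ξ ∈ hfin.toFinset, fourierCoef μ (f : Lp ℂ p μ) ξ • rieszChar p μ T ξ with hq
  have hgap : ∀ ξ ∈ hfin.toFinset, ξ ∈ T ∧ χ⁻¹ * ξ ∉ T := fun ξ hξ =>
    mem_coneGap.1 (hfin.mem_toFinset.1 hξ)
  have hqval : (q : Lp ℂ p μ) =
      ∑ ξ ∈ hfin.toFinset, fourierCoef μ (f : Lp ℂ p μ) ξ • charLp p μ ξ := by
    rw [hq, Submodule.coe_sum]
    refine Finset.sum_congr rfl fun ξ hξ => ?_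
    rw [Submodule.coe_smul, coe_rieszChar (hgap ξ hξ).1]
  have hmem : (charLp ∞ μ χ⁻¹ • ((f - q : hardy p μ T) : Lp ℂ p μ) : Lp ℂ p μ) ∈ hardy p μ T := by
    intro η hη
    rw [fourierCoef_charLp_smul, inv_inv]
    by_cases h : χ * η ∈ T
    · have h1 : χ * η ∈ hfin.toFinset :=
        hfin.mem_toFinset.2 (mem_coneGap.2 ⟨h, by rwa [inv_mul_cancel_left]⟩)
      rw [← fourierCoefCLM_apply, Submodule.coe_sub, map_sub, fourierCoefCLM_apply,
        fourierCoefCLM_apply, hqval, fourierCoef_sum_charLp, if_pos h1, sub_self]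
    · exact (f - q).2 _ h
  let g : hardy p μ T := ⟨_, hmem⟩
  have h1 : toeplitz p μ T (charLp ∞ μ χ⁻¹) f = g := by
    refine toeplitz_eq_of_mem_closure hp ?_
    have h2 : (charLp ∞ μ χ⁻¹ • (f : Lp ℂ p μ) : Lp ℂ p μ) =
        g + charLp ∞ μ χ⁻¹ • (q : Lp ℂ p μ) := by
      change _ = charLp ∞ μ χ⁻¹ • ((f - q : hardy p μ T) : Lp ℂ p μ) +
        charLp ∞ μ χ⁻¹ • (q : Lp ℂ p μ)
      rw [← Lp.add_smul, ← Submodule.coe_add, sub_add_cancel]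
    have h3 : (charLp ∞ μ χ⁻¹ • (q : Lp ℂ p μ) : Lp ℂ p μ) =
        ∑ ξ ∈ hfin.toFinset, fourierCoef μ (f : Lp ℂ p μ) ξ • charLp p μ (χ⁻¹ * ξ) := by
      have h4 := map_sum ((ContinuousLinearMap.mul ℂ ℂ).holderL μ ∞ p p (charLp ∞ μ χ⁻¹))
        (fun ξ => fourierCoef μ (f : Lp ℂ p μ) ξ • charLp p μ ξ) hfin.toFinset
      rw [hqval]
      refine h4.trans (Finset.sum_congr rfl fun ξ _ => ?_)
      rw [map_smul, ← charLp_smul_charLp]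
      rfl
    have h4 : ((charLp ∞ μ χ⁻¹ • (f : Lp ℂ p μ) : Lp ℂ p μ), g) = ((g : Lp ℂ p μ), g) +
        ∑ ξ ∈ hfin.toFinset, fourierCoef μ (f : Lp ℂ p μ) ξ •
          (charLp p μ (χ⁻¹ * ξ), rieszChar p μ T (χ⁻¹ * ξ)) := by
      refine Prod.ext ?_ ?_
      · rw [Prod.fst_add, Prod.fst_sum, h2, h3]
        rfl
      · rw [Prod.snd_add, Prod.snd_sum, Finset.sum_eq_zero, add_zero]
        intro ξ hξ
        rw [Prod.smul_snd, rieszChar_of_notMem (hgap ξ hξ).2, smul_zero]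
    rw [h4]
    exact add_mem (self_mem_closure hp g) (sum_mem fun ξ _ =>
      Submodule.smul_mem _ _ (char_rieszChar_mem_closure _))
  have h2 : toeplitz p μ T (charLp ∞ μ χ) g = f - q := by
    refine toeplitz_eq_of_smul_eq hp ?_
    exact (charLp_smul_smul χ χ⁻¹ _).trans (by rw [mul_inv_cancel, charLp_one_smul])
  rw [semicommutator_eq hp, h1, h2]
  abel

theorem isCompactOperator_semicommutator (hp : p ≠ ∞) {χ : PontryaginDual G}
    (hfin : (coneGap T χ).Finite) :
    IsCompactOperator (semicommutator p μ T (charLp ∞ μ χ) (star (charLp ∞ μ χ))) := by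
  let A : hardy p μ T →L[ℂ] hardy p μ T := -∑ ξ ∈ hfin.toFinset,
    ((fourierCoefCLM p μ ξ).comp (hardy p μ T).subtypeL).smulRight (rieszChar p μ T ξ)
  have hA : semicommutator p μ T (charLp ∞ μ χ) (star (charLp ∞ μ χ)) = A := by
    ext1 f
    rw [semicommutator_eq_neg_sum hp hfin]
    simp [A]
  have : A ∈ compactOperator (RingHom.id ℂ) (hardy p μ T) (hardy p μ T) := by
    refine neg_mem (sum_mem fun ξ _ => ?_)
    change IsCompactOperator fun f => _
    exact (isCompactOperator_of_locallyCompactSpace_dom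
      ((fourierCoefCLM p μ ξ).comp (hardy p μ T).subtypeL)).clm_comp
        (ContinuousLinearMap.toSpanSingleton ℂ (rieszChar p μ T ξ))
  rw [hA]
  exact this

/-- `T_χ̄` annihilates the characters in `T \ χT`. -/
theorem semicommutator_smul_rieszChar (hp : p ≠ ∞) {χ ξ : PontryaginDual G}
    (hξ : ξ ∈ coneGap T χ) (c : ℂ) :
    semicommutator p μ T (charLp ∞ μ χ) (star (charLp ∞ μ χ)) (c • rieszChar p μ T ξ) =
      -(c • rieszChar p μ T ξ) := by
  rw [mem_coneGap] at hξ
  have h1 : toeplitz p μ T (charLp ∞ μ χ⁻¹) (c • rieszChar p μ T ξ) = 0 := by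
    refine toeplitz_eq_of_mem_closure hp ?_
    have h2 : (charLp ∞ μ χ⁻¹ • ((c • rieszChar p μ T ξ : hardy p μ T) : Lp ℂ p μ) : Lp ℂ p μ) =
        c • charLp p μ (χ⁻¹ * ξ) := by
      rw [Submodule.coe_smul, coe_rieszChar hξ.1, ← Lp.smul_comm, charLp_smul_charLp]
    have h3 := Submodule.smul_mem (rieszPolGraph p μ T).topologicalClosure c
      (char_rieszChar_mem_closure (χ⁻¹ * ξ))
    rwa [rieszChar_of_notMem hξ.2, Prod.smul_mk, smul_zero, ← h2] at h3
  have h2 : toeplitz p μ T (charLp ∞ μ χ) 0 = 0 :=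
    toeplitz_eq_of_smul_eq hp (Lp.smul_zero ℂ p _)
  rw [semicommutator_eq hp, h1, h2, zero_sub]

theorem norm_charLp_le (ξ : PontryaginDual G) : ‖charLp p μ ξ‖ ≤ 1 := by
  refine (Lp.norm_le_of_ae_bound (C := 1) zero_le_one ?_).trans_eq ?_
  · filter_upwards [charLp_coeFn (p := p) μ ξ] with x hx
    rw [hx, Circle.norm_coe]
  · simp [measureUnivNNReal]

/-- The Fourier coefficient of `ξ - η` at `ξ` is `1`. -/
theorem one_le_norm_charLp_sub {ξ η : PontryaginDual G} (h : ξ ≠ η) :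
    1 ≤ ‖charLp p μ ξ - charLp p μ η‖ := by
  refine le_trans (le_of_eq ?_) (norm_fourierCoef_le p μ _ ξ)
  rw [← fourierCoefCLM_apply, map_sub, fourierCoefCLM_apply, fourierCoefCLM_apply,
    fourierCoef_charLp_self, fourierCoef_charLp h.symm, sub_zero, norm_one]

/-- On the unit vectors `ξ ∈ T \ χT`, which are at distance at least `1` from each other, the
semicommutator is `-1`. -/
theorem finite_coneGap_of_isCompactOperator (hp : p ≠ ∞) {χ : PontryaginDual G}
    (h : IsCompactOperator (semicommutator p μ T (charLp ∞ μ χ) (star (charLp ∞ μ χ)))) :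
    (coneGap T χ).Finite := by
  obtain ⟨K, hK, hnhds⟩ := h
  obtain ⟨r, hr, hball⟩ := Metric.mem_nhds_iff.1 hnhds
  have hr2 : 0 < r / 2 := half_pos hr
  have hr2n : ‖((r / 2 : ℝ) : ℂ)‖ = r / 2 := by rw [Complex.norm_real, Real.norm_of_nonneg hr2.le]
  let v : PontryaginDual G → hardy p μ T := fun ξ => ((r / 2 : ℝ) : ℂ) • rieszChar p μ T ξ
  have hv : ∀ ξ ∈ coneGap T χ, -v ξ ∈ K := fun ξ hξ => by
    rw [← semicommutator_smul_rieszChar hp hξ]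
    refine hball ?_
    rw [mem_ball_zero_iff, norm_smul, hr2n, ← Submodule.norm_coe, coe_rieszChar hξ.1]
    have := norm_charLp_le (p := p) (μ := μ) ξ
    nlinarith
  have hsep : ∀ ξ ∈ coneGap T χ, ∀ η ∈ coneGap T χ, ξ ≠ η → r / 2 ≤ dist (-v ξ) (-v η) := by
    intro ξ hξ η hη hne
    rw [dist_neg_neg, dist_eq_norm, ← smul_sub, norm_smul, hr2n, ← Submodule.norm_coe,
      Submodule.coe_sub, coe_rieszChar hξ.1, coe_rieszChar hη.1]
    have := one_le_norm_charLp_sub (p := p) (μ := μ) hne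
    nlinarith
  obtain ⟨t, ht, htK⟩ := Metric.totallyBounded_iff.1 hK.totallyBounded (r / 2 / 2) (half_pos hr2)
  have hcov : ∀ ξ ∈ coneGap T χ, ∃ y ∈ t, dist (-v ξ) y < r / 2 / 2 := fun ξ hξ => by
    simpa using htK (hv ξ hξ)
  choose! y hyt hy using hcov
  refine Set.Finite.of_finite_image (f := y) (ht.subset (Set.image_subset_iff.2 hyt)) ?_
  intro ξ hξ η hη he
  by_contra hne
  have h1 := hy ξ hξ
  have h2 := hy η hη
  rw [← he] at h2
  have h3 := dist_triangle_right (-v ξ) (-v η) (y ξ)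
  linarith [hsep ξ hξ η hη hne]

end Semicommutator

section Cyclic

/-! ### Ordered groups with finite order intervals, and the circle -/

/-- If all the sets `T \ χT`, that is, all the order intervals `[1, χ)`, are finite, then `X` is
cyclic, generated by its least positive element. -/
theorem exists_zpow_of_finite_coneGap {X : Type*} [CommGroup X] {T : Submonoid X}
    (hT : IsLinearPositiveCone T) (hfin : ∀ χ ∈ T, (coneGap T χ).Finite) :
    ∃ g : X, ∀ χ : X, ∃ n : ℤ, χ = g ^ n := by
  by_cases htriv : ∀ χ ∈ T, χ = 1
  · refine ⟨1, fun χ => ⟨0, ?_⟩⟩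
    rw [zpow_zero]
    rcases hT.total χ with h | h
    · exact htriv _ h
    · exact inv_eq_one.1 (htriv _ h)
  push Not at htriv
  have hlt : ∀ χ ∈ T, ∀ ξ ∈ coneGap T χ, (coneGap T ξ).ncard < (coneGap T χ).ncard := by
    intro χ hχ ξ hξ
    refine Set.ncard_lt_ncard ⟨fun η hη => ?_, fun hle => ?_⟩ (hfin χ hχ)
    · rw [mem_coneGap] at hξ hη ⊢
      refine ⟨hη.1, fun h => ?_⟩
      -- `ξ < χ` and `χ ≤ η` contradict `η < ξ`
      have h1 : ξ⁻¹ * χ ∈ T := by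
        rcases hT.total (ξ⁻¹ * χ) with h' | h'
        · exact h'
        · exact absurd (by simpa using h') hξ.2
      exact hη.2 (by simpa [mul_assoc] using T.mul_mem h1 h)
    · have := (mem_coneGap.1 (hle hξ)).2
      rw [inv_mul_cancel] at this
      exact this T.one_mem
  obtain ⟨g, ⟨hgT, hg1⟩, hmin⟩ := exists_minimalFor_of_wellFoundedLT
    (fun χ : X => χ ∈ T ∧ χ ≠ 1) (fun χ => (coneGap T χ).ncard) htriv
  have hgap : ∀ ξ ∈ coneGap T g, ξ = 1 := fun ξ hξ => by
    by_contra hne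
    have h1 := hlt g hgT ξ hξ
    exact absurd (hmin ⟨hξ.1, hne⟩ h1.le) (not_le.2 h1)
  have hpow : ∀ n : ℕ, ∀ χ ∈ T, (coneGap T χ).ncard = n → ∃ k : ℕ, χ = g ^ k := by
    intro n
    induction n using Nat.strong_induction_on with
    | _ n ih =>
    rintro χ hχ rfl
    by_cases h1 : χ = 1
    · exact ⟨0, by rw [h1, pow_zero]⟩
    have h2 : g⁻¹ * χ ∈ T := by
      by_contra h
      exact h1 (hgap χ (mem_coneGap.2 ⟨hχ, h⟩))
    have h3 : g⁻¹ * χ ∈ coneGap T χ := by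
      refine mem_coneGap.2 ⟨h2, fun h => hg1 (hT.eq_one g hgT ?_)⟩
      rwa [mul_left_comm, inv_mul_cancel, mul_one] at h
    obtain ⟨k, hk⟩ := ih _ (hlt χ hχ _ h3) _ h2 rfl
    exact ⟨k + 1, by rw [pow_succ', ← hk, mul_inv_cancel_left]⟩
  refine ⟨g, fun χ => ?_⟩
  rcases hT.total χ with h | h
  · obtain ⟨k, hk⟩ := hpow _ χ h rfl
    exact ⟨k, by rw [hk, zpow_natCast]⟩
  · obtain ⟨k, hk⟩ := hpow _ _ h rfl
    exact ⟨-k, by rw [zpow_neg, zpow_natCast, ← hk, inv_inv]⟩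

/-- The image of a nontrivial compact connected group is a connected subset of the circle with more
than one point, so it is uncountable. Its preimage in `ℝ` is then a closed subgroup that is not
cyclic, which must be `ℝ`. -/
theorem surjective_of_connectedSpace {G : Type*} [CommGroup G] [TopologicalSpace G]
    [CompactSpace G] [ConnectedSpace G] [Nontrivial G] (g : G →* Circle) (hg : Continuous g)
    (hinj : Function.Injective g) : Function.Surjective g := by
  let S : AddSubgroup ℝ :=
    (AddMonoidHom.range (MonoidHom.toAdditive g)).comap Circle.expHom
  have hmem : ∀ t : ℝ, t ∈ S ↔ Circle.exp t ∈ Set.range g := fun t => Iff.rfl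
  have hclosed : IsClosed (S : Set ℝ) :=
    (isCompact_range hg).isClosed.preimage Circle.exp.continuous
  rcases S.dense_or_cyclic with hdense | ⟨a, ha⟩
  · intro z
    obtain ⟨t, rfl⟩ := Circle.exp_surjective z
    have : t ∈ closure (S : Set ℝ) := hdense t
    rw [hclosed.closure_eq] at this
    exact (hmem t).1 this
  · have hScount : (S : Set ℝ).Countable := by
      rw [ha, ← AddSubgroup.zmultiples_eq_closure, AddSubgroup.coe_zmultiples]
      exact Set.countable_range _
    have hcount : (Set.range g).Countable := by
      refine (hScount.image Circle.exp).mono ?_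
      rintro z hz
      obtain ⟨t, rfl⟩ := Circle.exp_surjective z
      exact ⟨t, (hmem t).2 hz, rfl⟩
    have hsub := hcount.isTotallyDisconnected _ subset_rfl (isPreconnected_range hg)
    obtain ⟨x, y, hxy⟩ := exists_pair_ne G
    exact absurd (hinj (hsub ⟨x, rfl⟩ ⟨y, rfl⟩)) hxy

/-- A nontrivial compact connected abelian group whose characters are the powers of one character
`g` is isomorphic to the circle through `g`: as characters separate points, `g` is injective, and
its image is a nontrivial connected subgroup of the circle. -/
theorem nonempty_continuousMulEquiv_circle {G : Type*} [CommGroup G] [TopologicalSpace G]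
    [IsTopologicalGroup G] [CompactSpace G] [T2Space G] [ConnectedSpace G] [Nontrivial G]
    {g : PontryaginDual G} (hg : ∀ χ : PontryaginDual G, ∃ n : ℤ, χ = g ^ n) :
    Nonempty (G ≃ₜ* Circle) := by
  borelize G
  have hinj : Function.Injective g := by
    rw [injective_iff_map_eq_one]
    intro a ha
    by_contra hne
    obtain ⟨χ, hχ⟩ := exists_character_ne_one hne
    obtain ⟨n, rfl⟩ := hg χ
    exact hχ (by rw [show (g ^ n) a = g a ^ n from
      map_zpow (MonoidHom.mk' (fun χ : PontryaginDual G => χ a) fun _ _ => rfl) g n, ha, one_zpow])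
  have hcont : Continuous g := map_continuous g
  have hsurj : Function.Surjective g :=
    surjective_of_connectedSpace (g : G →* Circle) hcont hinj
  let e : G ≃ₜ Circle := hcont.homeoOfEquivCompactToT2 (f := Equiv.ofBijective g ⟨hinj, hsurj⟩)
  exact ⟨{ e with map_mul' := map_mul g }⟩

end Cyclic

end OrderedToeplitz

end

open OrderedToeplitz in
theorem mainTheorem7 {G : Type*} [CommGroup G] [TopologicalSpace G] [IsTopologicalGroup G]
    [CompactSpace G] [T2Space G] [ConnectedSpace G] [Nontrivial G]
    [MeasurableSpace G] [BorelSpace G]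
    (μ : Measure G) [μ.IsHaarMeasure] [μ.Regular] [IsProbabilityMeasure μ]
    (T : Submonoid (PontryaginDual G)) (hT : IsLinearPositiveCone T)
    (p : ℝ≥0∞) [Fact (1 ≤ p)] (hp : 1 < p) (hp' : p < ∞) :
    (∀ χ ∈ T,
      IsCompactOperator (semicommutator p μ T (charLp ∞ μ χ) (star (charLp ∞ μ χ))) ↔
        χ ∈ indexSet T) ∧
    ((∀ χ ∈ T,
      IsCompactOperator (semicommutator p μ T (charLp ∞ μ χ) (star (charLp ∞ μ χ)))) →
      Nonempty (G ≃ₜ* Circle)) := by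
  have hiff : ∀ χ ∈ T,
      (IsCompactOperator (semicommutator p μ T (charLp ∞ μ χ) (star (charLp ∞ μ χ))) ↔
        χ ∈ indexSet T) := fun χ hχ => by
    rw [mem_indexSet_iff hχ]
    exact ⟨finite_coneGap_of_isCompactOperator hp'.ne,
      isCompactOperator_semicommutator hp'.ne⟩
  refine ⟨hiff, fun h => ?_⟩
  obtain ⟨g, hg⟩ := exists_zpow_of_finite_coneGap hT fun χ hχ =>
    (mem_indexSet_iff hχ).1 ((hiff χ hχ).1 (h χ hχ))
  exact nonempty_continuousMulEquiv_circle hg
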